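/- **Setting.** For $\kappa\in\mathbb{C}$ let $E_\kappa(z)=\exp(z)+\kappa$ (with singular value $\kappa$), and let $I(E_\kappa)=\{z\in\mathbb{C}: E_\kappa^n(z)\to\infty\}$ be its set of escaping points. The parameter $\kappa$ is *nonescaping* if $\kappa\notin I(E_\kappa)$. For an external address $\underline{s}=s_1s_2s_3\dots\in\mathbb{Z}^{\mathbb{N}}$ and $t\in[0,\infty)$, let $\sigma$ be the shift, $F(t)=e^t-1$, $\mathcal{F}(\underline{s},t)=(\sigma(\underline{s}),F(t)-2\pi|s_2|)$, and $T(\underline{s},t)=t$. Put $$\overline{X}=\{(\underline{s},t): T(\mathcal{F}^n(\underline{s},t))\ge 0\text{ for all }n\ge 0\},\qquad X=\{x\in\overline{X}: T(\mathcal{F}^n(x))\to\infty\},$$ and $t_{\underline{s}}=\min\{t\ge 0:(\underline{s},t)\in\overline{X}\}$ (with $t_{\underline s}=\infty$ if there is no such $t$). Let $\mathcal{S}_0$ be the set of (exponentially bounded) addresses with $t_{\underline{s}}<\infty$. Let $\mathfrak{g}^\kappa_0(\underline{s},t)=t+2\pi i s_1$ and $\mathfrak{g}^\kappa_{k+1}(\underline{s},t)=\operatorname{Log}\bigl(\mathfrak{g}^\kappa_k(\mathcal{F}(\underline{s},t))-\kappa\bigr)+2\pi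 i s_1$, with the principal branch of the logarithm. For $K>2\pi+6$ with $|\kappa|\le K$ let $Q(K)=\max\{\log(4(K+\pi+3)),\pi+2\}$ and $Y_{Q(K)}=\{x\in\overline{X}:T(\mathcal{F}^n(x))\ge Q(K)\text{ for all }n\ge0\}$. On $Y_{Q(K)}$ the maps $\mathfrak{g}^\kappa_k$ converge. If $\kappa$ is nonescaping, then $\mathfrak{g}^\kappa:X\to I(E_\kappa)$ denotes the unique map that equals $\lim_k\mathfrak{g}^\kappa_k$ on $Y_{Q(K)}\cap X$ for all such $K$, satisfies $\mathfrak{g}^\kappa\circ\mathcal{F}=E_\kappa\circ\mathfrak{g}^\kappa$ on $X$, and is continuous along rays (i.e. $t\mapsto\mathfrak{g}^\kappa(\underline{s},t)$ is continuous on $\{t:(\underline{s},t)\in X\}$ for every $\underline{s}$); it is a bijection. The dynamic ray at address $\underline{s}\in\mathcal{S}_0$ is the curve $g^\kappa_{\underline{s}}(t)=\mathfrak{g}^\kappa(\underline{s},t+t_{\underline{s}})$, $t>0$, and its limit set is $\bigcap_{t>0}\overline{g^\kappa_{\underline{s}}((0,t))}\subset\mathbb{C}$. **Theorem (Rigidity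 for Parameters with Different Combinatorics).** Let $\underline{s}\in\mathcal{S}_0$, and let $\tilde\kappa$ and $\kappa$ be nonescaping parameters. Suppose that the limit set of $g^{\tilde\kappa}_{\underline{s}}$ contains the singular value $\tilde\kappa$, while the limit set of $g^{\kappa}_{\underline{s}}$ is nonempty and bounded and does not contain the singular value $\kappa$. Then the map $\mathfrak{g}^{\tilde\kappa}\circ(\mathfrak{g}^{\kappa})^{-1}: I(E_\kappa)\to I(E_{\tilde\kappa})$ is not continuous. -/

import Mathlib

open Filter Topology Set

noncomputable section

namespace ExpDynamics

/-- The exponential map `E_κ(z) = exp z + κ`; its singular value is `κ`. -/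
def E (κ z : ℂ) : ℂ := Complex.exp z + κ

/-- The set of escaping points `I(E_κ) = {z : E_κ^n(z) → ∞}`. -/
def escapingSet (κ : ℂ) : Set ℂ :=
  {z | Tendsto (fun n : ℕ => (E κ)^[n] z) atTop (cocompact ℂ)}

/-- External addresses `s₁ s₂ s₃ …`; the entry `s_{k+1}` is stored as `s k`. -/
abbrev Address : Type := ℕ → ℤ

/-- The shift map `σ` on external addresses. -/
def shift (s : Address) : Address := fun k => s (k + 1)

/-- The model dynamics `𝓕(s, t) = (σ(s), F(t) - 2π|s₂|)` with `F(t) = exp t - 1`. -/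
def modelMap (x : Address × ℝ) : Address × ℝ :=
  (shift x.1, (Real.exp x.2 - 1) - 2 * Real.pi * |(x.1 1 : ℝ)|)

/-- The set `X̄` of all `(s, t)` all of whose iterates under `𝓕` have nonnegative potential. -/
def Xbar : Set (Address × ℝ) :=
  {x | ∀ n : ℕ, 0 ≤ (modelMap^[n] x).2}

/-- The model `X` of the escaping set: the points of `X̄` whose potentials tend to infinity. -/
def X : Set (Address × ℝ) :=
  {x | x ∈ Xbar ∧ Tendsto (fun n : ℕ => (modelMap^[n] x).2) atTop atTop}

/-- `s` is exponentially bounded (`s ∈ 𝓢₀`): `t_s < ∞`, i.e. some `(s, t)` lies in `X̄`. -/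
def ExpBounded (s : Address) : Prop := ∃ t : ℝ, (s, t) ∈ Xbar

/-- The minimal potential `t_s = min {t ≥ 0 : (s, t) ∈ X̄}` of an exponentially bounded address. -/
def minPotential (s : Address) : ℝ := sInf {t : ℝ | (s, t) ∈ Xbar}

/-- `Z(s, t) = t + 2πi s₁`. -/
def Z (x : Address × ℝ) : ℂ := (x.2 : ℂ) + 2 * Real.pi * Complex.I * (x.1 0 : ℂ)

/-- The inverse branch `L_k(w) = Log(w - κ) + 2πi k` of `E_κ`. -/
def L (κ : ℂ) (k : ℤ) (w : ℂ) : ℂ := Complex.log (w - κ) + 2 * Real.pi * Complex.I * (k : ℂ)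

/-- The approximations `𝔤₀ = Z`, `𝔤_{k+1}(s, t) = L_{s₁}(𝔤_k(𝓕(s, t)))`. -/
def gApprox (κ : ℂ) : ℕ → Address × ℝ → ℂ
  | 0, x => Z x
  | k + 1, x => L κ (x.1 0) (gApprox κ k (modelMap x))

/-- `Q(K) = max {log(4(K + π + 3)), π + 2}`. -/
def Q (K : ℝ) : ℝ := max (Real.log (4 * (K + Real.pi + 3))) (Real.pi + 2)

/-- `Y_q`: the points of `X̄` all of whose iterates have potential at least `q`. -/
def Y (q : ℝ) : Set (Address × ℝ) :=
  {x | x ∈ Xbar ∧ ∀ n : ℕ, q ≤ (modelMap^[n] x).2}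

/-- `G` is, on `X`, the extension of the limit of the maps `𝔤_k` (which is defined where all
potentials along the orbit are large) that is equivariant and continuous along rays. By
`IsCorrespondence.eqOn` such an extension is unique on `X`. -/
structure IsCorrespondence (κ : ℂ) (G : Address × ℝ → ℂ) : Prop where
  extends_limit : ∀ K : ℝ, 2 * Real.pi + 6 < K → ‖κ‖ ≤ K → ∀ x ∈ Y (Q K) ∩ X,
    Tendsto (fun k : ℕ => gApprox κ k x) atTop (𝓝 (G x))
  equivariant : ∀ x ∈ X, G (modelMap x) = E κ (G x)
  continuous_along_rays : ∀ s : Address,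
    ContinuousOn (fun t : ℝ => G (s, t)) {t : ℝ | (s, t) ∈ X}

/-- The canonical map `𝔤^κ : X → I(E_κ)`, for nonescaping `κ` (values outside `X` are
irrelevant). -/
def corr (κ : ℂ) : Address × ℝ → ℂ := Classical.epsilon (IsCorrespondence κ)

/-- The inverse `(𝔤^κ)⁻¹ : I(E_κ) → X` of the bijection `𝔤^κ : X → I(E_κ)`. -/
def corrInv (κ : ℂ) : ℂ → Address × ℝ := Function.invFunOn (corr κ) X

/-- The dynamic ray `g_s^κ(t) = 𝔤^κ(s, t + t_s)`, `t > 0`. -/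
def ray (κ : ℂ) (s : Address) (t : ℝ) : ℂ := corr κ (s, t + minPotential s)

/-- The limit set `⋂_{t > 0} closure (g((0, t)))` of a curve `g : (0, ∞) → ℂ`. -/
def limitSet (g : ℝ → ℂ) : Set ℂ := ⋂ t ∈ Ioi (0 : ℝ), closure (g '' Ioo 0 t)

/-! Uniqueness of the correspondence on `X`. -/

theorem iterate_fst (s : Address) (t u : ℝ) (n : ℕ) :
    (modelMap^[n] (s, t)).1 = (modelMap^[n] (s, u)).1 := by
  induction n with
  | zero => rfl
  | succ n ih => simp only [Function.iterate_succ_apply', modelMap, ih]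

theorem iterate_snd_mono {s : Address} {t u : ℝ} (h : (s, t) ∈ Xbar) (htu : t ≤ u) (n : ℕ) :
    u - t ≤ (modelMap^[n] (s, u)).2 - (modelMap^[n] (s, t)).2 := by
  induction n with
  | zero => simp
  | succ n ih =>
    have h0 : 0 ≤ (modelMap^[n] (s, t)).2 := h n
    have hf := iterate_fst s t u n
    simp only [Function.iterate_succ_apply', modelMap, hf]
    set a := (modelMap^[n] (s, t)).2
    set b := (modelMap^[n] (s, u)).2
    have h1 : Real.exp b = Real.exp a * Real.exp (b - a) := by
      rw [← Real.exp_add]; congr 1; ring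
    have h2 := Real.add_one_le_exp (b - a)
    have h3 := Real.one_le_exp h0
    have h4 : 0 ≤ b - a := by linarith
    nlinarith [mul_nonneg (sub_nonneg.2 h3) (sub_nonneg.2 h2)]

theorem mem_X_of_le {s : Address} {t u : ℝ} (h : (s, t) ∈ X) (htu : t ≤ u) : (s, u) ∈ X := by
  have hm : ∀ n, (modelMap^[n] (s, t)).2 ≤ (modelMap^[n] (s, u)).2 := fun n => by
    have := iterate_snd_mono h.1 htu n
    linarith
  exact ⟨fun n => (h.1 n).trans (hm n), tendsto_atTop_mono hm h.2⟩

theorem modelMap_mem_X {x : Address × ℝ} (h : x ∈ X) : modelMap x ∈ X := by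
  refine ⟨fun n => ?_, ?_⟩
  · rw [← Function.iterate_succ_apply]; exact h.1 (n + 1)
  · have := (tendsto_add_atTop_iff_nat 1).2 h.2
    simpa only [Function.iterate_succ_apply] using this

theorem exists_iterate_mem_Y {x : Address × ℝ} (h : x ∈ X) (q : ℝ) :
    ∃ n : ℕ, modelMap^[n] x ∈ Y q := by
  obtain ⟨n, hn⟩ := eventually_atTop.1 (h.2.eventually_ge_atTop q)
  refine ⟨n, fun m => ?_, fun m => ?_⟩
  · rw [← Function.iterate_add_apply]; exact h.1 _
  · rw [← Function.iterate_add_apply]; exact hn _ (Nat.le_add_left n m)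

theorem eq_zero_of_exp_eq_one {d : ℝ → ℂ} {a b : ℝ} (hab : a ≤ b)
    (hc : ContinuousOn d (Icc a b)) (he : ∀ u ∈ Icc a b, Complex.exp (d u) = 1)
    (hb : d b = 0) : d a = 0 := by
  have hT : IsDiscrete (range ((↑) : ℤ → ℝ)) :=
    Int.isClosedEmbedding_coe_real.toIsEmbedding.toIsInducing.isDiscrete_range
  have hmaps : MapsTo (fun u => (d u).im / (2 * Real.pi)) (Icc a b) (range ((↑) : ℤ → ℝ)) := by
    intro u hu
    obtain ⟨n, hn⟩ := Complex.exp_eq_one_iff.1 (he u hu)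
    refine ⟨n, ?_⟩
    have : (d u).im = n * (2 * Real.pi) := by rw [hn]; simp
    simp only [this]
    field_simp
  have hcont : ContinuousOn (fun u => (d u).im / (2 * Real.pi)) (Icc a b) :=
    (Complex.continuous_im.comp_continuousOn hc).div_const _
  have hconst := isPreconnected_Icc.constant_of_mapsTo hT hcont hmaps
    (left_mem_Icc.2 hab) (right_mem_Icc.2 hab)
  obtain ⟨n, hn⟩ := Complex.exp_eq_one_iff.1 (he a (left_mem_Icc.2 hab))
  have h1 : (d a).im = n * (2 * Real.pi) := by rw [hn]; simp
  have h2 : (n : ℝ) = 0 := by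
    have := Real.pi_pos
    simp only [hb, h1, Complex.zero_im, zero_div] at hconst
    field_simp at hconst
    exact_mod_cast hconst
  have h3 : n = 0 := by exact_mod_cast h2
  simpa [h3] using hn

/-- Two correspondences for the same parameter agree on `X`. -/
theorem IsCorrespondence.eqOn {κ : ℂ} {G H : Address × ℝ → ℂ}
    (hG : IsCorrespondence κ G) (hH : IsCorrespondence κ H) : EqOn G H X := by
  obtain ⟨K, hK1, hK2⟩ : ∃ K : ℝ, 2 * Real.pi + 6 < K ∧ ‖κ‖ ≤ K :=
    ⟨max (2 * Real.pi + 7) ‖κ‖, lt_of_lt_of_le (by linarith) (le_max_left _ _), le_max_right _ _⟩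
  have hQ : 0 ≤ Q K := by
    have := Real.pi_pos
    exact le_trans (by linarith) (le_max_right _ _)
  have base : ∀ x ∈ Y (Q K) ∩ X, G x = H x := fun x hx =>
    tendsto_nhds_unique (hG.extends_limit K hK1 hK2 x hx) (hH.extends_limit K hK1 hK2 x hx)
  have key : ∀ n : ℕ, ∀ x ∈ X, modelMap^[n] x ∈ Y (Q K) → G x = H x := by
    intro n
    induction n with
    | zero => exact fun x hx hy => base x ⟨hy, hx⟩
    | succ n ih =>
      rintro ⟨s, t⟩ hx hy
      have hsub : Icc t (t + Q K) ⊆ {u : ℝ | (s, u) ∈ X} := fun u hu => mem_X_of_le hx hu.1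
      have hd := eq_zero_of_exp_eq_one (d := fun u => G (s, u) - H (s, u))
        (a := t) (b := t + Q K) (by linarith)
        (((hG.continuous_along_rays s).mono hsub).sub ((hH.continuous_along_rays s).mono hsub))
        ?_ ?_
      · exact sub_eq_zero.1 hd
      · intro u hu
        have hX : (s, u) ∈ X := hsub hu
        have hY : modelMap^[n] (modelMap (s, u)) ∈ Y (Q K) := by
          rw [← Function.iterate_succ_apply]
          refine ⟨fun m => ?_, fun m => ?_⟩
          · rw [← Function.iterate_add_apply]; exact hX.1 _
          · have h1 := hy.2 m
            rw [← Function.iterate_add_apply] at h1 ⊢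
            have h2 := iterate_snd_mono hx.1 hu.1 (m + (n + 1))
            have h3 := hu.1
            linarith
        have h := ih _ (modelMap_mem_X hX) hY
        rw [hG.equivariant _ hX, hH.equivariant _ hX] at h
        have h' : Complex.exp (G (s, u)) = Complex.exp (H (s, u)) := add_right_cancel h
        change Complex.exp (G (s, u) - H (s, u)) = 1
        rw [Complex.exp_sub, h', div_self (Complex.exp_ne_zero _)]
      · have hle : t ≤ t + Q K := by linarith
        have hX : (s, t + Q K) ∈ X := mem_X_of_le hx hle
        refine sub_eq_zero.2 (base _ ⟨⟨hX.1, fun m => ?_⟩, hX⟩)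
        have h1 := iterate_snd_mono hx.1 hle m
        have h2 := hx.1 m
        linarith
  intro x hx
  obtain ⟨n, hn⟩ := exists_iterate_mem_Y hx (Q K)
  exact key n x hx hn

end ExpDynamics

end

/-!
The map `f = 𝔤^κ' ∘ (𝔤^κ)⁻¹` conjugates `E κ` to `E κ'` on escaping sets, and it sends the point of
potential `t` on the ray `g_s^κ` to the point of potential `t` on `g_s^κ'`, together with all iterated
preimages of the two points (`iterate_corr_corrInv`).

Suppose that `f` is continuous at an escaping point `p`, so that `f` is bounded by some `M` on the
escaping points of a neighbourhood `U` of `p`. Since the limit set of `g_s^κ` is nonempty, bounded and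
does not contain `κ`, the points `g_s^κ(t)` with `t` small lie in a round annulus about `κ`
(`exists_annulus_of_limitSet`). As `p` escapes, some iterate `E κ^N` with `N ≥ 1` maps `U` onto a set
containing this annulus (`exists_annulus_subset_iterate_image`). Now `N` is fixed, and `κ'` has a
positive distance from the compact set `E κ'^N {|z| ≤ M}`, because it is an omitted value
(`exists_le_dist_iterate`). But `κ'` lies in the limit set of `g_s^κ'`, so there is an arbitrarily
small `t` for which `g_s^κ'(t)` is closer to `κ'` than that. A point `z ∈ U` with
`E κ^N z = g_s^κ(t)` escapes and satisfies `E κ'^N (f z) = g_s^κ'(t)`, hence `|f z| > M`: contradiction.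
Since `z` is an arbitrary preimage, no control of the winding of the rays around the singular values
is needed.

This uses that `𝔤^κ` exists for nonescaping `κ`, is injective, and has a backward invariant image.
For existence, the inverse branches `L κ k` contract by the factor `2` at high potentials, which gives
the limit of the `𝔤_k` there (`log_estimates`, `tendsto_gApprox`). It is extended to `X` one preimage at
a time by lifting along rays through the covering map `exp`
(`IsPartialCorrespondence.exists_succ`); the lift exists because the curves to be lifted consist of
escaping points and so avoid `κ`. For injectivity, the orbit of `𝔤(x)` shadows the model orbit of `x`,
and therefore determines its address and its potentials (`baseMap_injOn`).
-/

open Filter Topology Set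

namespace ExpDynamics

/-! ### Continuous logarithms over convex sets of parameters -/

theorem existsUnique_log_lift {J : Set ℝ} (hJ : Convex ℝ J) {φ : ℝ → ℂ} (hφ : ContinuousOn φ J)
    (h0 : ∀ u ∈ J, φ u ≠ 0) {T : ℝ} (hT : T ∈ J) {c : ℂ} (hc : Complex.exp c = φ T) :
    ∃! F : C(J, ℂ), F ⟨T, hT⟩ = c ∧ Complex.exp ∘ F = J.domRestrict φ := by
  have : ContractibleSpace J := hJ.contractibleSpace ⟨T, hT⟩
  have : LocallyPathConnectedSpace J := hJ.locallyPathConnectedSpace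
  exact Complex.isCoveringMapOn_exp.existsUnique_continuousMap_lifts
    ⟨J.domRestrict φ, continuousOn_iff_continuous_domRestrict.1 hφ⟩ hc fun u => h0 u u.2

theorem exists_continuousOn_log {J : Set ℝ} (hJ : Convex ℝ J) {φ : ℝ → ℂ}
    (hφ : ContinuousOn φ J) (h0 : ∀ u ∈ J, φ u ≠ 0) {T : ℝ} (hT : T ∈ J) {c : ℂ}
    (hc : Complex.exp c = φ T) :
    ∃ ψ : ℝ → ℂ, ContinuousOn ψ J ∧ ψ T = c ∧ ∀ u ∈ J, Complex.exp (ψ u) = φ u := by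
  classical
  obtain ⟨F, ⟨hFT, hF⟩, -⟩ := existsUnique_log_lift hJ hφ h0 hT hc
  refine ⟨fun u => if h : u ∈ J then F ⟨u, h⟩ else 0, ?_, by simp [hT, hFT], fun u hu => ?_⟩
  · rw [continuousOn_iff_continuous_domRestrict]
    convert! map_continuous F with u
    simp
  · simpa [hu] using congr($hF ⟨u, hu⟩)

theorem eqOn_of_exp_eq {J : Set ℝ} (hJ : Convex ℝ J) {f g : ℝ → ℂ} (hf : ContinuousOn f J)
    (hg : ContinuousOn g J) (he : ∀ u ∈ J, Complex.exp (f u) = Complex.exp (g u)) {T : ℝ}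
    (hT : T ∈ J) (hfg : f T = g T) : EqOn f g J := by
  obtain ⟨F, -, hF⟩ := existsUnique_log_lift (φ := fun u => Complex.exp (g u)) hJ
    hg.cexp (fun u _ => Complex.exp_ne_zero _) hT rfl
  have h1 := hF ⟨J.domRestrict f, continuousOn_iff_continuous_domRestrict.1 hf⟩
    ⟨hfg, funext fun u => he u u.2⟩
  have h2 := hF ⟨J.domRestrict g, continuousOn_iff_continuous_domRestrict.1 hg⟩
    ⟨rfl, rfl⟩
  intro u hu
  exact congr($(h1.trans h2.symm) ⟨u, hu⟩)

/-! ### The model dynamics -/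

theorem iterate_fst_eq (x : Address × ℝ) (n k : ℕ) : (modelMap^[n] x).1 k = x.1 (n + k) := by
  induction n generalizing k with
  | zero => simp
  | succ n ih =>
    rw [Function.iterate_succ_apply']
    change (modelMap^[n] x).1 (k + 1) = _
    rw [ih, Nat.add_right_comm, Nat.add_assoc]

theorem mem_Y_iff {q : ℝ} (hq : 0 ≤ q) {x : Address × ℝ} :
    x ∈ Y q ↔ ∀ n, q ≤ (modelMap^[n] x).2 :=
  ⟨fun h => h.2, fun h => ⟨fun n => hq.trans (h n), h⟩⟩

theorem modelMap_mem_Y {q : ℝ} {x : Address × ℝ} (h : x ∈ Y q) : modelMap x ∈ Y q := by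
  refine ⟨fun n => ?_, fun n => ?_⟩ <;> rw [← Function.iterate_succ_apply]
  exacts [h.1 _, h.2 _]

theorem mem_Y_add {q : ℝ} {s : Address} {t u : ℝ} (hq : 0 ≤ q) (h : (s, t) ∈ Xbar)
    (htu : t + q ≤ u) : (s, u) ∈ Y q := by
  rw [mem_Y_iff hq]
  intro n
  have h1 := iterate_snd_mono h (show t ≤ u by linarith) n
  have h2 := h n
  linarith

theorem Y_anti {q r : ℝ} (h : q ≤ r) : Y r ⊆ Y q := fun _ hx => ⟨hx.1, fun n => h.trans (hx.2 n)⟩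

theorem iterate_mem_X {x : Address × ℝ} (h : x ∈ X) (n : ℕ) : modelMap^[n] x ∈ X := by
  induction n with
  | zero => exact h
  | succ n ih => rw [Function.iterate_succ_apply']; exact modelMap_mem_X ih

theorem iterate_mem_Y {q : ℝ} {x : Address × ℝ} (h : x ∈ Y q) (n : ℕ) :
    modelMap^[n] x ∈ Y q := by
  induction n with
  | zero => exact h
  | succ n ih => rw [Function.iterate_succ_apply']; exact modelMap_mem_Y ih

/-- Two points of different potentials at one address separate at least linearly, because
`e^b - e^a ≥ (b - a) + (b - a)² / 2` for `0 ≤ a ≤ b`. -/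
theorem iterate_snd_gap {s : Address} {t u : ℝ} (h : (s, t) ∈ Xbar) (htu : t < u) (n : ℕ) :
    (n : ℝ) * ((u - t) ^ 2 / 2) ≤ (modelMap^[n] (s, u)).2 - (modelMap^[n] (s, t)).2 := by
  induction n with
  | zero => simpa using htu.le
  | succ n ih =>
    have h0 : 0 ≤ (modelMap^[n] (s, t)).2 := h n
    have hf := iterate_fst s t u n
    have hd := iterate_snd_mono h htu.le n
    simp only [Function.iterate_succ_apply', modelMap, hf]
    set a := (modelMap^[n] (s, t)).2
    set b := (modelMap^[n] (s, u)).2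
    have h1 : Real.exp b = Real.exp a * Real.exp (b - a) := by
      rw [← Real.exp_add]; congr 1; ring
    have h2 := Real.quadratic_le_exp_of_nonneg (show 0 ≤ b - a by linarith)
    have h3 := Real.one_le_exp h0
    have h4 : (u - t) ^ 2 ≤ (b - a) ^ 2 := by
      apply pow_le_pow_left₀ <;> linarith
    have h5 : 0 ≤ Real.exp (b - a) - 1 := by nlinarith [sq_nonneg (b - a)]
    push_cast
    nlinarith [mul_nonneg (sub_nonneg.2 h3) h5]

theorem mem_X_of_lt {s : Address} {t u : ℝ} (h : (s, t) ∈ Xbar) (htu : t < u) : (s, u) ∈ X := by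
  have hm : ∀ n, (modelMap^[n] (s, t)).2 ≤ (modelMap^[n] (s, u)).2 := fun n => by
    have := iterate_snd_mono h htu.le n
    linarith
  refine ⟨fun n => (h n).trans (hm n), ?_⟩
  refine tendsto_atTop_mono (f := fun n : ℕ => (n : ℝ) * ((u - t) ^ 2 / 2)) (fun n => ?_) ?_
  · have h1 := iterate_snd_gap h htu n
    have h2 := h n
    linarith
  · exact tendsto_natCast_atTop_atTop.atTop_mul_const (by have := sub_pos.2 htu; positivity)

theorem add_minPotential_mem_X {s : Address} (hs : ExpBounded s) {t : ℝ} (ht : 0 < t) :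
    (s, t + minPotential s) ∈ X := by
  obtain ⟨u, hu, hlt⟩ := exists_lt_of_csInf_lt (s := {t : ℝ | (s, t) ∈ Xbar}) hs
    (show minPotential s < t + minPotential s by linarith)
  exact mem_X_of_lt hu hlt

theorem mem_X_of_modelMap {x : Address × ℝ} (hx : 0 ≤ x.2) (h : modelMap x ∈ X) : x ∈ X := by
  refine ⟨fun n => ?_, (tendsto_add_atTop_iff_nat 1).1 ?_⟩
  · cases n with
    | zero => exact hx
    | succ n => rw [Function.iterate_succ_apply]; exact h.1 n
  · simpa only [Function.iterate_succ_apply] using h.2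

/-- `𝓕 : X → X` is surjective, and the first entry of a preimage can be prescribed. -/
theorem exists_modelMap_eq {y : Address × ℝ} (hy : y ∈ X) (j : ℤ) :
    ∃ x ∈ X, modelMap x = y ∧ x.1 0 = j := by
  obtain ⟨s, t⟩ := y
  have ht : 0 ≤ t := hy.1 0
  have hpos : 1 ≤ 1 + t + 2 * Real.pi * |(s 0 : ℝ)| := by
    have : 0 ≤ 2 * Real.pi * |(s 0 : ℝ)| := by positivity
    linarith
  have hmap : modelMap (fun k => Nat.casesOn k j s,
      Real.log (1 + t + 2 * Real.pi * |(s 0 : ℝ)|)) = (s, t) := by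
    refine Prod.ext rfl ?_
    change Real.exp (Real.log _) - 1 - 2 * Real.pi * |(s 0 : ℝ)| = t
    rw [Real.exp_log (by linarith)]
    ring
  exact ⟨_, mem_X_of_modelMap (Real.log_nonneg hpos) (hmap ▸ hy), hmap, rfl⟩

theorem modelMap_congr {s s' : Address} (h : shift s = shift s') (t : ℝ) :
    modelMap (s, t) = modelMap (s', t) := by
  have : s 1 = s' 1 := congr_fun h 0
  simp [modelMap, h, this]

/-- The model `X` is invariant under changing the first entry of the address. -/
theorem mem_X_congr {s s' : Address} (h : shift s = shift s') {t : ℝ} (hx : (s, t) ∈ X) :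
    (s', t) ∈ X :=
  mem_X_of_modelMap (hx.1 0) (modelMap_congr h t ▸ modelMap_mem_X hx)

/-! ### The limit of the approximations at high potentials -/

/-- The infimum of the constants `K` that are admissible in the definition of a correspondence.
The convergence estimates hold for this value too, and so for all admissible `K` at once. -/
noncomputable def paramBound (κ : ℂ) : ℝ := max (2 * Real.pi + 6) ‖κ‖

/-- The potential above which the maps `𝔤_k` converge. -/
noncomputable def baseLevel (κ : ℂ) : ℝ := Q (paramBound κ)

theorem norm_le_paramBound (κ : ℂ) : ‖κ‖ ≤ paramBound κ := le_max_right _ _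

theorem le_paramBound (κ : ℂ) : 2 * Real.pi + 6 ≤ paramBound κ := le_max_left _ _

theorem pi_add_two_le_baseLevel (κ : ℂ) : Real.pi + 2 ≤ baseLevel κ := le_max_right _ _

theorem baseLevel_nonneg (κ : ℂ) : 0 ≤ baseLevel κ := by
  have := pi_add_two_le_baseLevel κ
  have := Real.pi_pos
  linarith

theorem baseLevel_le_Q {κ : ℂ} {K : ℝ} (h1 : 2 * Real.pi + 6 < K) (h2 : ‖κ‖ ≤ K) :
    baseLevel κ ≤ Q K := by
  have h3 := le_paramBound κ
  have h4 : paramBound κ ≤ K := max_le h1.le h2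
  have := Real.pi_pos
  exact max_le_max (Real.log_le_log (by linarith) (by linarith)) le_rfl

theorem le_exp_of_baseLevel_le {κ : ℂ} {t : ℝ} (h : baseLevel κ ≤ t) :
    4 * (paramBound κ + Real.pi + 3) ≤ Real.exp t := by
  have h3 := le_paramBound κ
  have := Real.pi_pos
  exact (Real.log_le_iff_le_exp (by linarith)).1 ((le_max_left _ _).trans h)

/-- The image of the disc of radius `π + 2` about `Z(𝓕(x)) - κ` under the branch of the logarithm
belonging to `x` lies in the disc of this radius about `Z(x)`. The disc avoids the cut of the
logarithm, since one of `T(𝓕(x))` and `2π|s₂|`, whose sum is `F(t)`, exceeds `K + π + 2`. -/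
theorem log_estimates {κ : ℂ} {x : Address × ℝ} (h0 : baseLevel κ ≤ x.2)
    (h1 : baseLevel κ ≤ (modelMap x).2) {w : ℂ}
    (hw : ‖w - (Z (modelMap x) - κ)‖ ≤ Real.pi + 2) :
    w ∈ Complex.slitPlane ∧ 2 ≤ ‖w‖ ∧
      ‖Complex.log w + 2 * Real.pi * Complex.I * (x.1 0 : ℂ) - Z x‖ ≤ Real.pi + 2 := by
  have hπ := Real.pi_gt_three
  have hK := norm_le_paramBound κ
  have hK6 := le_paramBound κ
  have hE := le_exp_of_baseLevel_le h0
  have ht1 : 0 ≤ (modelMap x).2 := (baseLevel_nonneg κ).trans h1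
  set K := paramBound κ
  set t₁ := (modelMap x).2 with ht₁
  set m : ℝ := (x.1 1 : ℝ) with hm
  have hsum : t₁ + 2 * Real.pi * |m| = Real.exp x.2 - 1 := by simp [ht₁, hm, modelMap]
  have hZ : Z (modelMap x) = (t₁ : ℂ) + 2 * Real.pi * Complex.I * (m : ℂ) := by
    simp [Z, hm, modelMap, shift, ht₁]
  have hZre : (Z (modelMap x)).re = t₁ := by simp [hZ]
  have hZim : (Z (modelMap x)).im = 2 * Real.pi * m := by simp [hZ]
  have habs : |2 * Real.pi * m| = 2 * Real.pi * |m| := by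
    rw [abs_mul, abs_of_pos (by positivity)]
  have hdist : ‖w - Z (modelMap x)‖ ≤ K + Real.pi + 2 := by
    calc ‖w - Z (modelMap x)‖ = ‖(w - (Z (modelMap x) - κ)) - κ‖ := by ring_nf
      _ ≤ ‖w - (Z (modelMap x) - κ)‖ + ‖κ‖ := norm_sub_le _ _
      _ ≤ K + Real.pi + 2 := by linarith
  have hre := (Complex.abs_re_le_norm _).trans hdist
  have him := (Complex.abs_im_le_norm _).trans hdist
  rw [Complex.sub_re, hZre, abs_le] at hre
  rw [Complex.sub_im, hZim] at him
  have hup : ‖Z (modelMap x)‖ ≤ Real.exp x.2 - 1 := by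
    refine (Complex.norm_le_abs_re_add_abs_im _).trans ?_
    rw [hZre, hZim, habs, abs_of_nonneg ht1, hsum]
  have hlow : 7 / 10 * (Real.exp x.2 - 1) ≤ ‖Z (modelMap x)‖ := by
    have h0 : 0 ≤ 7 / 10 * (Real.exp x.2 - 1) := by linarith
    refine (sq_le_sq₀ h0 (norm_nonneg _)).1 ?_
    rw [Complex.sq_norm, Complex.normSq_apply, hZre, hZim, ← hsum]
    have : 2 * Real.pi * m * (2 * Real.pi * m) = (2 * Real.pi * |m|) * (2 * Real.pi * |m|) := by
      rw [← habs, abs_mul_abs_self]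
    rw [this]
    nlinarith [sq_nonneg (t₁ - 2 * Real.pi * |m|), sq_nonneg (t₁ + 2 * Real.pi * |m|)]
  have h3 : ‖w‖ ≤ ‖Z (modelMap x)‖ + (K + Real.pi + 2) := by
    have := norm_le_norm_add_norm_sub' w (Z (modelMap x))
    linarith
  have h4 : ‖Z (modelMap x)‖ ≤ ‖w‖ + (K + Real.pi + 2) := by
    have := norm_le_norm_add_norm_sub (w) (Z (modelMap x))
    linarith
  have hw2 : 2 ≤ ‖w‖ := by linarith
  refine ⟨?_, hw2, ?_⟩
  · rw [Complex.mem_slitPlane_iff]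
    by_contra! hc
    rw [hc.2, zero_sub, abs_neg, habs] at him
    linarith [hc.1, hre.1]
  · have e1 : Complex.log w + 2 * Real.pi * Complex.I * (x.1 0 : ℂ) - Z x
        = ((Real.log ‖w‖ - x.2 : ℝ) : ℂ) + (w.arg : ℂ) * Complex.I := by
      simp only [Z, Complex.log]; push_cast; ring
    have e2 : |Real.log ‖w‖ - x.2| ≤ 1 := by
      have hpos : 0 < ‖w‖ := by linarith
      have ha : Real.log ‖w‖ ≤ x.2 + 1 := by
        rw [Real.log_le_iff_le_exp hpos, Real.exp_add]
        have := Real.exp_one_gt_d9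
        nlinarith [Real.exp_pos x.2]
      have hb : x.2 - 1 ≤ Real.log ‖w‖ := by
        rw [Real.le_log_iff_exp_le hpos, Real.exp_sub, div_le_iff₀ (Real.exp_pos 1)]
        have := Real.exp_one_gt_d9
        nlinarith [Real.exp_pos x.2]
      rw [abs_le]; constructor <;> linarith
    rw [e1]
    refine (norm_add_le _ _).trans ?_
    rw [norm_mul, Complex.norm_I, mul_one, Complex.norm_real, Complex.norm_real,
      Real.norm_eq_abs, Real.norm_eq_abs]
    linarith [Complex.abs_arg_le_pi w]

theorem norm_log_sub_log_le {c : ℂ} {r : ℝ} (hs : Metric.closedBall c r ⊆ Complex.slitPlane)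
    (h2 : ∀ w ∈ Metric.closedBall c r, 2 ≤ ‖w‖) {w z : ℂ} (hw : w ∈ Metric.closedBall c r)
    (hz : z ∈ Metric.closedBall c r) :
    ‖Complex.log w - Complex.log z‖ ≤ 1 / 2 * ‖w - z‖ := by
  refine (convex_closedBall c r).norm_image_sub_le_of_norm_hasDerivWithin_le (f' := fun w => w⁻¹)
    (fun u hu => ((Complex.hasStrictDerivAt_log (hs hu)).hasDerivAt).hasDerivWithinAt)
    (fun u hu => ?_) hz hw
  rw [norm_inv]
  exact (inv_anti₀ (by norm_num) (h2 u hu)).trans (by norm_num)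

section Base

variable {κ : ℂ} {x : Address × ℝ}

theorem mem_closedBall_of_mem_Y (hx : x ∈ Y (baseLevel κ)) {w : ℂ}
    (hw : w ∈ Metric.closedBall (Z (modelMap x) - κ) (Real.pi + 2)) :
    w ∈ Complex.slitPlane ∧ 2 ≤ ‖w‖ ∧
      ‖Complex.log w + 2 * Real.pi * Complex.I * (x.1 0 : ℂ) - Z x‖ ≤ Real.pi + 2 :=
  log_estimates (hx.2 0) (hx.2 1) (mem_closedBall_iff_norm.1 hw)

theorem norm_gApprox_sub_Z_le (k : ℕ) (hx : x ∈ Y (baseLevel κ)) :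
    ‖gApprox κ k x - Z x‖ ≤ Real.pi + 2 := by
  induction k generalizing x with
  | zero => simp only [gApprox, sub_self, norm_zero]; positivity
  | succ k ih =>
    refine (log_estimates (hx.2 0) (hx.2 1) ?_).2.2
    have := ih (modelMap_mem_Y hx)
    rwa [sub_sub_sub_cancel_right]

theorem gApprox_sub_mem_closedBall (k : ℕ) (hx : x ∈ Y (baseLevel κ)) :
    gApprox κ k (modelMap x) - κ ∈ Metric.closedBall (Z (modelMap x) - κ) (Real.pi + 2) := by
  rw [mem_closedBall_iff_norm, sub_sub_sub_cancel_right]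
  exact norm_gApprox_sub_Z_le k (modelMap_mem_Y hx)

theorem dist_gApprox_succ_le (k : ℕ) (hx : x ∈ Y (baseLevel κ)) :
    dist (gApprox κ k x) (gApprox κ (k + 1) x) ≤ 2 * (Real.pi + 2) / 2 / 2 ^ k := by
  induction k generalizing x with
  | zero =>
    have := norm_gApprox_sub_Z_le 1 hx
    rw [dist_comm, dist_eq_norm]
    simpa [gApprox] using this
  | succ k ih =>
    have h1 := norm_log_sub_log_le (fun w hw => (mem_closedBall_of_mem_Y hx hw).1)
      (fun w hw => (mem_closedBall_of_mem_Y hx hw).2.1) (gApprox_sub_mem_closedBall k hx)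
      (gApprox_sub_mem_closedBall (k + 1) hx)
    have h2 := ih (modelMap_mem_Y hx)
    rw [sub_sub_sub_cancel_right, ← dist_eq_norm, ← dist_eq_norm] at h1
    change dist (L κ _ _) (L κ _ _) ≤ _
    rw [L, L, dist_add_right, pow_succ]
    calc _ ≤ _ := h1
      _ ≤ 1 / 2 * (2 * (Real.pi + 2) / 2 / 2 ^ k) := by gcongr
      _ = _ := by field_simp

/-- The limit of the maps `𝔤_k`. It exists on `Y (baseLevel κ)`; elsewhere the value may be arbitrary. -/
noncomputable def baseMap (κ : ℂ) (x : Address × ℝ) : ℂ := limUnder atTop fun k => gApprox κ k x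

theorem tendsto_gApprox (hx : x ∈ Y (baseLevel κ)) :
    Tendsto (fun k => gApprox κ k x) atTop (𝓝 (baseMap κ x)) :=
  (cauchySeq_of_le_geometric_two fun k => dist_gApprox_succ_le k hx).tendsto_limUnder

theorem norm_baseMap_sub_Z_le (hx : x ∈ Y (baseLevel κ)) : ‖baseMap κ x - Z x‖ ≤ Real.pi + 2 :=
  le_of_tendsto ((tendsto_gApprox hx).sub_const _).norm
    (Eventually.of_forall fun k => norm_gApprox_sub_Z_le k hx)

theorem baseMap_sub_mem_closedBall (hx : x ∈ Y (baseLevel κ)) :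
    baseMap κ (modelMap x) - κ ∈ Metric.closedBall (Z (modelMap x) - κ) (Real.pi + 2) := by
  rw [mem_closedBall_iff_norm, sub_sub_sub_cancel_right]
  exact norm_baseMap_sub_Z_le (modelMap_mem_Y hx)

theorem baseMap_eq_L (hx : x ∈ Y (baseLevel κ)) :
    baseMap κ x = L κ (x.1 0) (baseMap κ (modelMap x)) := by
  refine tendsto_nhds_unique ((tendsto_gApprox hx).comp (tendsto_add_atTop_nat 1)) ?_
  have hs := (mem_closedBall_of_mem_Y hx (baseMap_sub_mem_closedBall hx)).1
  exact (((tendsto_gApprox (modelMap_mem_Y hx)).sub_const κ).clog hs).add_const _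

theorem exp_two_pi_int (k : ℤ) : Complex.exp (2 * Real.pi * Complex.I * (k : ℂ)) = 1 :=
  Complex.exp_eq_one_iff.2 ⟨k, mul_comm _ _⟩

theorem E_L {κ w : ℂ} (k : ℤ) (h : w - κ ≠ 0) : E κ (L κ k w) = w := by
  rw [E, L, Complex.exp_add, Complex.exp_log h, exp_two_pi_int, mul_one, sub_add_cancel]

theorem E_baseMap (hx : x ∈ Y (baseLevel κ)) : E κ (baseMap κ x) = baseMap κ (modelMap x) := by
  rw [baseMap_eq_L hx]
  exact E_L _ (Complex.slitPlane_ne_zero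
    (mem_closedBall_of_mem_Y hx (baseMap_sub_mem_closedBall hx)).1)

theorem iterate_E_baseMap (hx : x ∈ Y (baseLevel κ)) (n : ℕ) :
    (E κ)^[n] (baseMap κ x) = baseMap κ (modelMap^[n] x) := by
  induction n with
  | zero => rfl
  | succ n ih =>
    rw [Function.iterate_succ_apply', Function.iterate_succ_apply', ih,
      E_baseMap (iterate_mem_Y hx n)]

theorem continuousOn_gApprox (k : ℕ) (s : Address) :
    ContinuousOn (fun t : ℝ => gApprox κ k (s, t)) {t | (s, t) ∈ Y (baseLevel κ)} := by
  induction k generalizing s with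
  | zero => simp only [gApprox, Z]; fun_prop
  | succ k ih =>
    have h1 : ContinuousOn (fun t : ℝ => gApprox κ k (modelMap (s, t)))
        {t | (s, t) ∈ Y (baseLevel κ)} := by
      refine (ih (shift s)).comp (f := fun t : ℝ => (modelMap (s, t)).2) ?_ ?_
      · simp only [modelMap]; fun_prop
      · exact fun t ht => modelMap_mem_Y (x := (s, t)) ht
    refine ((h1.sub continuousOn_const).clog fun t ht => ?_).add
      (continuousOn_const (c := 2 * Real.pi * Complex.I * (s 0 : ℂ)))
    exact (mem_closedBall_of_mem_Y ht (gApprox_sub_mem_closedBall k ht)).1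

theorem continuousOn_baseMap (s : Address) :
    ContinuousOn (fun t : ℝ => baseMap κ (s, t)) {t | (s, t) ∈ Y (baseLevel κ)} := by
  have hu : TendstoUniformlyOn (fun k (t : ℝ) => gApprox κ k (s, t))
      (fun t => baseMap κ (s, t)) atTop {t | (s, t) ∈ Y (baseLevel κ)} := by
    rw [Metric.tendstoUniformlyOn_iff]
    intro ε hε
    have hz : Tendsto (fun k : ℕ => 2 * (Real.pi + 2) / 2 ^ k) atTop (𝓝 0) := by
      simpa [div_eq_mul_inv] using
        (tendsto_inv_atTop_zero.comp (tendsto_pow_atTop_atTop_of_one_lt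
          (one_lt_two (α := ℝ)))).const_mul (2 * (Real.pi + 2))
    filter_upwards [hz.eventually_lt_const hε] with k hk t ht
    rw [dist_comm]
    exact (dist_le_of_le_geometric_two_of_tendsto (fun k => dist_gApprox_succ_le k ht)
      (tendsto_gApprox ht) k).trans_lt hk
  exact hu.continuousOn (Frequently.of_forall fun k => continuousOn_gApprox k s)

/-- At sufficiently high potentials the point `𝔤(s, t)` lies in the strip
`|Im z - 2πs₁| < π/2`. -/
theorem abs_im_baseMap_lt (hx : x ∈ Y (baseLevel κ))
    (h1 : paramBound κ + Real.pi + 2 < (modelMap x).2) :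
    |(baseMap κ x).im - 2 * Real.pi * x.1 0| < Real.pi / 2 := by
  have h2 := norm_baseMap_sub_Z_le (modelMap_mem_Y hx)
  have h3 := (abs_le.1 ((Complex.abs_re_le_norm _).trans h2)).1
  have h4 := (abs_le.1 ((Complex.abs_re_le_norm κ).trans (norm_le_paramBound κ))).2
  have h5 : (Z (modelMap x)).re = (modelMap x).2 := by simp [Z]
  rw [Complex.sub_re, h5] at h3
  have h6 : |(baseMap κ (modelMap x) - κ).arg| < Real.pi / 2 := by
    rw [Complex.abs_arg_lt_pi_div_two_iff]
    left
    rw [Complex.sub_re]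
    linarith
  rw [baseMap_eq_L hx]
  simpa [L, Complex.log_im] using h6

end Base

/-! ### Extending the limit along rays -/

theorem mem_escapingSet_iff {κ z : ℂ} :
    z ∈ escapingSet κ ↔ Tendsto (fun n : ℕ => ‖(E κ)^[n] z‖) atTop atTop := by
  rw [escapingSet, mem_ofPred_eq, ← Metric.cobounded_eq_cocompact,
    tendsto_norm_atTop_iff_cobounded]

theorem iterate_E_mem_escapingSet {κ z : ℂ} {n : ℕ} :
    (E κ)^[n] z ∈ escapingSet κ ↔ z ∈ escapingSet κ := by
  rw [mem_escapingSet_iff, mem_escapingSet_iff]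
  simp only [← Function.iterate_add_apply]
  exact tendsto_add_atTop_iff_nat n (f := fun m => ‖(E κ)^[m] z‖)

theorem baseMap_mem_escapingSet {κ : ℂ} {x : Address × ℝ} (hx : x ∈ X)
    (hY : x ∈ Y (baseLevel κ)) : baseMap κ x ∈ escapingSet κ := by
  rw [mem_escapingSet_iff]
  refine tendsto_atTop_mono (fun n => ?_) (tendsto_atTop_add_const_right _ (-(Real.pi + 2)) hx.2)
  rw [iterate_E_baseMap hY]
  have h1 := norm_baseMap_sub_Z_le (iterate_mem_Y hY n)
  have h2 := (abs_le.1 ((Complex.abs_re_le_norm _).trans h1)).1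
  have h3 : (Z (modelMap^[n] x)).re = (modelMap^[n] x).2 := by simp [Z]
  rw [Complex.sub_re, h3] at h2
  have h4 := Complex.re_le_norm (baseMap κ (modelMap^[n] x))
  linarith

/-- The points of `X` whose `n`-th image lies at potentials where the approximations converge. -/
def stage (κ : ℂ) (n : ℕ) : Set (Address × ℝ) := {x | x ∈ X ∧ modelMap^[n] x ∈ Y (baseLevel κ)}

/-- `G` is an extension of `baseMap κ` to `stage κ n` that is equivariant and continuous along
rays. -/
structure IsPartialCorrespondence (κ : ℂ) (n : ℕ) (G : Address × ℝ → ℂ) : Prop where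
  eq_baseMap : ∀ x ∈ X, x ∈ Y (baseLevel κ) → G x = baseMap κ x
  continuousOn : ∀ s : Address, ContinuousOn (fun t : ℝ => G (s, t)) {t | (s, t) ∈ stage κ n}
  equivariant : ∀ x ∈ stage κ n, E κ (G x) = G (modelMap x)

section Stage

variable {κ : ℂ} {n : ℕ} {x : Address × ℝ}

theorem mem_stage_of_le {s : Address} {t u : ℝ} (h : (s, t) ∈ stage κ n) (htu : t ≤ u) :
    (s, u) ∈ stage κ n := by
  refine ⟨mem_X_of_le h.1 htu, fun m => ?_, fun m => ?_⟩ <;> rw [← Function.iterate_add_apply]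
  · exact (mem_X_of_le h.1 htu).1 _
  · have h1 := h.2.2 m
    rw [← Function.iterate_add_apply] at h1
    have h2 := iterate_snd_mono h.1.1 htu (m + n)
    linarith

theorem convex_stage (s : Address) : Convex ℝ {t | (s, t) ∈ stage κ n} := by
  refine (OrdConnected.mk ?_).convex
  exact fun t ht u _ v hv => mem_stage_of_le ht hv.1

theorem stage_subset_succ : stage κ n ⊆ stage κ (n + 1) := fun x hx =>
  ⟨hx.1, by rw [Function.iterate_succ_apply']; exact modelMap_mem_Y hx.2⟩

theorem stage_mono : Monotone (stage κ) := monotone_nat_of_le_succ fun _ => stage_subset_succ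

theorem mem_stage_of_mem_Y (hx : x ∈ X) (h : x ∈ Y (baseLevel κ)) : x ∈ stage κ n :=
  ⟨hx, iterate_mem_Y h n⟩

theorem modelMap_mem_stage (hx : x ∈ stage κ n) : modelMap x ∈ stage κ n :=
  ⟨modelMap_mem_X hx.1, by
    rw [← Function.iterate_succ_apply, Function.iterate_succ_apply']; exact modelMap_mem_Y hx.2⟩

theorem modelMap_mem_stage_of_succ (hx : x ∈ stage κ (n + 1)) : modelMap x ∈ stage κ n :=
  ⟨modelMap_mem_X hx.1, by rw [← Function.iterate_succ_apply]; exact hx.2⟩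

theorem exists_mem_stage (κ : ℂ) (hx : x ∈ X) : ∃ n, x ∈ stage κ n :=
  (exists_iterate_mem_Y hx (baseLevel κ)).imp fun _ h => ⟨hx, h⟩

end Stage

namespace IsPartialCorrespondence

variable {κ : ℂ} {n : ℕ} {G : Address × ℝ → ℂ}

theorem iterate_apply (hG : IsPartialCorrespondence κ n G) {x : Address × ℝ}
    (hx : x ∈ stage κ n) (m : ℕ) : (E κ)^[m] (G x) = G (modelMap^[m] x) := by
  induction m generalizing x with
  | zero => rfl
  | succ m ih =>
    rw [Function.iterate_succ_apply, Function.iterate_succ_apply, hG.equivariant x hx,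
      ih (modelMap_mem_stage hx)]

theorem mem_escapingSet (hG : IsPartialCorrespondence κ n G) {x : Address × ℝ}
    (hx : x ∈ stage κ n) : G x ∈ escapingSet κ := by
  rw [← iterate_E_mem_escapingSet (n := n), hG.iterate_apply hx,
    hG.eq_baseMap _ (iterate_mem_X hx.1 n) hx.2]
  exact baseMap_mem_escapingSet (iterate_mem_X hx.1 n) hx.2

/-- One step of the extension. On `stage κ (n + 1)` the function `G ∘ 𝓕 - κ` is defined,
continuous along rays and, as `κ` does not escape, without zeros; so it has a continuous logarithm
along each ray that continues `G`. -/
theorem exists_succ (hκ : κ ∉ escapingSet κ) (hG : IsPartialCorrespondence κ n G) :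
    ∃ G', IsPartialCorrespondence κ (n + 1) G' ∧ EqOn G G' (stage κ n) := by
  have key : ∀ s : Address, ∃ ψ : ℝ → ℂ, ContinuousOn ψ {t | (s, t) ∈ stage κ (n + 1)} ∧
      (∀ t, (s, t) ∈ stage κ (n + 1) → Complex.exp (ψ t) + κ = G (modelMap (s, t))) ∧
      ∀ t, (s, t) ∈ stage κ n → ψ t = G (s, t) := by
    intro s
    by_cases hne : ∃ t, (s, t) ∈ stage κ (n + 1)
    · obtain ⟨t, ht⟩ := hne
      -- At a potential `T` this high both `baseMap` and `G` are defined.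
      set T := t + baseLevel κ with hT
      have hTX : (s, T) ∈ X := mem_X_of_le ht.1 (by linarith [baseLevel_nonneg κ])
      have hTY : (s, T) ∈ Y (baseLevel κ) := mem_Y_add (baseLevel_nonneg κ) ht.1.1 le_rfl
      have hTn : ∀ m, (s, T) ∈ stage κ m := fun m => mem_stage_of_mem_Y hTX hTY
      have hφ : ContinuousOn (fun t => G (modelMap (s, t)) - κ)
          {t | (s, t) ∈ stage κ (n + 1)} := by
        refine ContinuousOn.sub ?_ continuousOn_const
        refine (hG.continuousOn (shift s)).comp (f := fun t : ℝ => (modelMap (s, t)).2) ?_ ?_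
        · simp only [modelMap]; fun_prop
        · exact fun t ht => modelMap_mem_stage_of_succ (x := (s, t)) ht
      obtain ⟨ψ, hψ, hψT, hψe⟩ := exists_continuousOn_log (convex_stage s) hφ
        (fun u hu h0 => hκ (by
          have := hG.mem_escapingSet (modelMap_mem_stage_of_succ hu)
          rwa [sub_eq_zero.1 h0] at this)) (hTn _)
        (c := G (s, T)) (by
          rw [← hG.equivariant _ (hTn n), E, add_sub_cancel_right])
      refine ⟨ψ, hψ, fun t ht => by rw [hψe t ht, sub_add_cancel], ?_⟩
      refine eqOn_of_exp_eq (convex_stage s) (hψ.mono fun u hu => stage_subset_succ hu)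
        (hG.continuousOn s) (fun u hu => ?_) (hTn n) hψT
      rw [hψe u (stage_subset_succ hu), ← hG.equivariant _ hu, E, add_sub_cancel_right]
    · push Not at hne
      refine ⟨0, continuousOn_const, fun t ht => absurd ht (hne t), fun t ht => ?_⟩
      exact absurd (stage_subset_succ ht) (hne t)
  choose ψ hψc hψe hψG using key
  have heq : EqOn G (fun x => ψ x.1 x.2) (stage κ n) := fun x hx => (hψG x.1 x.2 hx).symm
  refine ⟨fun x => ψ x.1 x.2, ⟨fun x hX hY => ?_, hψc, fun x hx => ?_⟩, heq⟩
  · exact (heq (mem_stage_of_mem_Y hX hY)).symm.trans (hG.eq_baseMap x hX hY)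
  · exact (hψe x.1 x.2 hx).trans (heq (modelMap_mem_stage_of_succ hx))

end IsPartialCorrespondence

theorem isPartialCorrespondence_baseMap (κ : ℂ) : IsPartialCorrespondence κ 0 (baseMap κ) where
  eq_baseMap _ _ _ := rfl
  continuousOn s := (continuousOn_baseMap s).mono fun _ h => h.2
  equivariant _ h := E_baseMap h.2

theorem exists_isCorrespondence {κ : ℂ} (hκ : κ ∉ escapingSet κ) :
    ∃ G, IsCorrespondence κ G := by
  choose! next hnext heq using fun (n : ℕ) (G : Address × ℝ → ℂ)
    (h : IsPartialCorrespondence κ n G) => h.exists_succ hκ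
  let Gs : ℕ → Address × ℝ → ℂ := fun n => Nat.rec (baseMap κ) next n
  have hGs : ∀ n, IsPartialCorrespondence κ n (Gs n) := by
    intro n
    induction n with
    | zero => exact isPartialCorrespondence_baseMap κ
    | succ n ih => exact hnext n _ ih
  have hstep : ∀ m n, m ≤ n → EqOn (Gs m) (Gs n) (stage κ m) := by
    intro m n hmn
    induction n, hmn using Nat.le_induction with
    | base => exact fun _ _ => rfl
    | succ n hmn ih =>
      exact fun x hx => (ih hx).trans (heq n _ (hGs n) (stage_mono hmn hx))
  classical
  let G : Address × ℝ → ℂ := fun x => if h : ∃ n, x ∈ stage κ n then Gs (Nat.find h) x else 0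
  have hG : ∀ n, EqOn G (Gs n) (stage κ n) := by
    intro n x hx
    have h : ∃ n, x ∈ stage κ n := ⟨n, hx⟩
    simp only [G, dif_pos h]
    exact hstep _ _ (Nat.find_min' h hx) (Nat.find_spec h)
  refine ⟨G, fun K hK1 hK2 x hx => ?_, fun x hx => ?_, fun s t ht => ?_⟩
  · have hY : x ∈ Y (baseLevel κ) := Y_anti (baseLevel_le_Q hK1 hK2) hx.1
    rw [hG 0 ⟨hx.2, hY⟩]
    exact tendsto_gApprox hY
  · obtain ⟨n, hn⟩ := exists_mem_stage κ hx
    rw [hG n hn, hG n (modelMap_mem_stage hn), (hGs n).equivariant x hn]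
  · -- Choose the stage for a potential below `t` if there is one; it then contains a
    -- neighbourhood of `t` in the ray.
    obtain ⟨t₀, ht₀, hnhds⟩ : ∃ t₀, (s, t₀) ∈ X ∧ Ici t₀ ∈ 𝓝[{u | (s, u) ∈ X}] t := by
      by_cases h : ∃ t₀ < t, (s, t₀) ∈ X
      · obtain ⟨t₀, hlt, h₀⟩ := h
        exact ⟨t₀, h₀, mem_nhdsWithin_of_mem_nhds (Ici_mem_nhds hlt)⟩
      · push Not at h
        refine ⟨t, ht, mem_of_superset self_mem_nhdsWithin fun u hu => ?_⟩
        by_contra hlt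
        exact h u (not_le.1 hlt) hu
    obtain ⟨n, hn⟩ := exists_mem_stage κ ht₀
    have hsub : Ici t₀ ⊆ {u | (s, u) ∈ stage κ n} := fun u hu => mem_stage_of_le hn hu
    have hmem := mem_of_superset hnhds hsub
    have htn : t ∈ {u | (s, u) ∈ stage κ n} := mem_of_mem_nhdsWithin ht hmem
    have h1 : ContinuousWithinAt (fun u => Gs n (s, u)) {u | (s, u) ∈ X} t :=
      ((hGs n).continuousOn s t htn).mono_of_mem_nhdsWithin hmem
    refine h1.congr_of_eventuallyEq ?_ (hG n htn)
    filter_upwards [hmem] with u hu using hG n hu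

theorem isCorrespondence_corr {κ : ℂ} (hκ : κ ∉ escapingSet κ) : IsCorrespondence κ (corr κ) :=
  Classical.epsilon_spec (exists_isCorrespondence hκ)

/-! ### Bijectivity of the correspondence -/

/-- A potential above which a correspondence is the limit of the `𝔤_k` and the address of a point
can be read off from the imaginary parts along its orbit. -/
noncomputable def topLevel (κ : ℂ) : ℝ :=
  max (Q (paramBound κ + 1)) (paramBound κ + Real.pi + 3)

theorem baseLevel_le_topLevel (κ : ℂ) : baseLevel κ ≤ topLevel κ :=
  (baseLevel_le_Q (by linarith [le_paramBound κ]) (by linarith [norm_le_paramBound κ])).trans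
    (le_max_left _ _)

theorem topLevel_nonneg (κ : ℂ) : 0 ≤ topLevel κ :=
  (baseLevel_nonneg κ).trans (baseLevel_le_topLevel κ)

/-- A point of `X` at high potentials is determined by its image. The imaginary parts along the
orbit of the image determine the address, and two potentials at the same address would separate
under iteration. -/
theorem baseMap_injOn (κ : ℂ) : InjOn (baseMap κ) (Y (topLevel κ)) := by
  have hb : ∀ {x}, x ∈ Y (topLevel κ) → x ∈ Y (baseLevel κ) :=
    fun h => Y_anti (baseLevel_le_topLevel κ) h
  rintro ⟨s, t⟩ hx ⟨s', t'⟩ hx' h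
  have hn : ∀ n, baseMap κ (modelMap^[n] (s, t)) = baseMap κ (modelMap^[n] (s', t')) := fun n => by
    rw [← iterate_E_baseMap (hb hx), ← iterate_E_baseMap (hb hx'), h]
  have hlevel : ∀ {y}, y ∈ Y (topLevel κ) → paramBound κ + Real.pi + 2 < (modelMap y).2 := by
    intro y hy
    have h1 : topLevel κ ≤ (modelMap y).2 := hy.2 1
    have h2 : paramBound κ + Real.pi + 3 ≤ topLevel κ := le_max_right _ _
    linarith
  have hs : s = s' := by
    funext n
    have h1 := abs_im_baseMap_lt (iterate_mem_Y (hb hx) n) (hlevel (iterate_mem_Y hx n))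
    have h2 := abs_im_baseMap_lt (iterate_mem_Y (hb hx') n) (hlevel (iterate_mem_Y hx' n))
    rw [iterate_fst_eq, add_zero, abs_lt] at h1 h2
    rw [← hn n] at h2
    simp only at h1 h2
    have hπ := Real.pi_pos
    have h3 : ((s n : ℝ) - s' n) < 1 := by
      have : (s n - s' n : ℝ) * Real.pi < 1 * Real.pi := by nlinarith
      exact lt_of_mul_lt_mul_right this hπ.le
    have h4 : ((s' n : ℝ) - s n) < 1 := by
      have : (s' n - s n : ℝ) * Real.pi < 1 * Real.pi := by nlinarith
      exact lt_of_mul_lt_mul_right this hπ.le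
    have h5 : s n - s' n < 1 := by exact_mod_cast h3
    have h6 : s' n - s n < 1 := by exact_mod_cast h4
    omega
  subst hs
  -- Both orbits of potentials stay within bounded distance of the same real parts.
  have hclose : ∀ n, |(modelMap^[n] (s, t)).2 - (modelMap^[n] (s, t')).2|
      ≤ 2 * (Real.pi + 2) := by
    intro n
    have h1 := (Complex.abs_re_le_norm _).trans (norm_baseMap_sub_Z_le (iterate_mem_Y (hb hx) n))
    have h2 := (Complex.abs_re_le_norm _).trans (norm_baseMap_sub_Z_le (iterate_mem_Y (hb hx') n))
    rw [← hn n] at h2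
    have h3 : ∀ y, (Z y).re = y.2 := fun y => by simp [Z]
    rw [Complex.sub_re, h3, abs_le] at h1 h2
    rw [abs_le]
    constructor <;> linarith
  have main : ∀ a b, (s, a) ∈ Xbar → (∀ n, |(modelMap^[n] (s, a)).2 - (modelMap^[n] (s, b)).2|
      ≤ 2 * (Real.pi + 2)) → ¬ a < b := by
    intro a b ha hab hlt
    have hpos : 0 < (b - a) ^ 2 / 2 := by have := sub_pos.2 hlt; positivity
    obtain ⟨n, hn⟩ := exists_nat_gt (2 * (Real.pi + 2) / ((b - a) ^ 2 / 2))
    rw [div_lt_iff₀ hpos] at hn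
    have h1 := iterate_snd_gap ha hlt n
    have h2 := (abs_le.1 (hab n)).1
    linarith
  have h1 := main t t' hx.1 hclose
  have h2 := main t' t hx'.1 fun n => by rw [abs_sub_comm]; exact hclose n
  rw [le_antisymm (not_lt.1 h2) (not_lt.1 h1)]

namespace IsCorrespondence

variable {κ : ℂ} {G : Address × ℝ → ℂ}

theorem eq_baseMap (hG : IsCorrespondence κ G) {x : Address × ℝ} (hx : x ∈ X)
    (hY : x ∈ Y (topLevel κ)) : G x = baseMap κ x :=
  tendsto_nhds_unique
    (hG.extends_limit (paramBound κ + 1) (by linarith [le_paramBound κ])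
      (by linarith [norm_le_paramBound κ]) x ⟨Y_anti (le_max_left _ _) hY, hx⟩)
    (tendsto_gApprox (Y_anti (baseLevel_le_topLevel κ) hY))

theorem iterate_apply (hG : IsCorrespondence κ G) {x : Address × ℝ} (hx : x ∈ X) (n : ℕ) :
    (E κ)^[n] (G x) = G (modelMap^[n] x) := by
  induction n generalizing x with
  | zero => rfl
  | succ n ih =>
    rw [Function.iterate_succ_apply, Function.iterate_succ_apply, ← hG.equivariant x hx,
      ih (modelMap_mem_X hx)]

theorem mem_escapingSet (hG : IsCorrespondence κ G) {x : Address × ℝ} (hx : x ∈ X) :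
    G x ∈ escapingSet κ := by
  obtain ⟨n, hn⟩ := exists_iterate_mem_Y hx (topLevel κ)
  rw [← iterate_E_mem_escapingSet (n := n), hG.iterate_apply hx,
    hG.eq_baseMap (iterate_mem_X hx n) hn]
  exact baseMap_mem_escapingSet (iterate_mem_X hx n) (Y_anti (baseLevel_le_topLevel κ) hn)

/-- Changing the first entry of the address translates the ray by a multiple of `2πi`. -/
theorem apply_congr (hG : IsCorrespondence κ G) {s s' : Address} (h : shift s = shift s')
    {t : ℝ} (ht : (s, t) ∈ X) :
    G (s', t) = G (s, t) + 2 * Real.pi * Complex.I * ((s' 0 - s 0 : ℤ) : ℂ) := by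
  have h' : ∀ u, (s, u) ∈ X → (s', u) ∈ X := fun u hu => mem_X_congr h hu
  have hconv : Convex ℝ {u | (s, u) ∈ X} := by
    refine (OrdConnected.mk ?_).convex
    exact fun u hu v _ w hw => mem_X_of_le hu hw.1
  set T := t + topLevel κ
  have hT : (s, T) ∈ X := mem_X_of_le ht (by linarith [topLevel_nonneg κ])
  have hTY : (s, T) ∈ Y (topLevel κ) := mem_Y_add (topLevel_nonneg κ) ht.1 le_rfl
  have hTY' : (s', T) ∈ Y (topLevel κ) := mem_Y_add (topLevel_nonneg κ) (h' t ht).1 le_rfl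
  refine eqOn_of_exp_eq (f := fun u => G (s', u))
    (g := fun u => G (s, u) + 2 * Real.pi * Complex.I * ((s' 0 - s 0 : ℤ) : ℂ)) hconv
    ((hG.continuous_along_rays s').mono h')
    ((hG.continuous_along_rays s).add continuousOn_const) (fun u hu => ?_) hT ?_ ht
  · have h1 := hG.equivariant _ hu
    rw [modelMap_congr h, hG.equivariant _ (h' u hu)] at h1
    rw [Complex.exp_add, exp_two_pi_int, mul_one]
    exact add_right_cancel h1
  · rw [hG.eq_baseMap (h' T hT) hTY', hG.eq_baseMap hT hTY,
      baseMap_eq_L (Y_anti (baseLevel_le_topLevel κ) hTY),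
      baseMap_eq_L (Y_anti (baseLevel_le_topLevel κ) hTY'), modelMap_congr h]
    simp only [L]
    push_cast
    ring

theorem injOn (hG : IsCorrespondence κ G) : InjOn G X := by
  have key : ∀ n, ∀ x ∈ X, ∀ y ∈ X, G x = G y → modelMap^[n] x ∈ Y (topLevel κ) →
      modelMap^[n] y ∈ Y (topLevel κ) → x = y := by
    intro n
    induction n with
    | zero =>
      intro x hx y hy h hx' hy'
      rw [hG.eq_baseMap hx hx', hG.eq_baseMap hy hy'] at h
      exact baseMap_injOn κ hx' hy' h
    | succ n ih =>
      rintro ⟨s, t⟩ hx ⟨s', t'⟩ hy h hx' hy'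
      have h1 := ih _ (modelMap_mem_X hx) _ (modelMap_mem_X hy)
        (by rw [hG.equivariant _ hx, hG.equivariant _ hy, h]) hx' hy'
      have hs : shift s = shift s' := congr_arg Prod.fst h1
      have ht : t = t' := by
        rw [modelMap_congr hs] at h1
        simpa [modelMap] using congr_arg Prod.snd h1
      subst ht
      rw [hG.apply_congr hs hx, left_eq_add] at h
      have h0 : s' 0 - s 0 = 0 := by
        have := Complex.two_pi_I_ne_zero
        exact_mod_cast (mul_eq_zero.1 h).resolve_left this
      have : s = s' := by
        funext k
        cases k with
        | zero => omega
        | succ k => exact congr_fun hs k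
      rw [this]
  intro x hx y hy h
  obtain ⟨m, hm⟩ := exists_iterate_mem_Y hx (topLevel κ)
  obtain ⟨n, hn⟩ := exists_iterate_mem_Y hy (topLevel κ)
  refine key (m + n) x hx y hy h ?_ ?_
  · rw [add_comm, Function.iterate_add_apply]; exact iterate_mem_Y hm n
  · rw [Function.iterate_add_apply]; exact iterate_mem_Y hn m

theorem exists_apply_eq (hG : IsCorrespondence κ G) {y : Address × ℝ} (hy : y ∈ X) {z : ℂ}
    (hz : E κ z = G y) : ∃ x ∈ X, modelMap x = y ∧ G x = z := by
  obtain ⟨⟨s, t⟩, hx, rfl, hs⟩ := exists_modelMap_eq hy 0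
  rw [hG.equivariant _ hx] at hz
  obtain ⟨m, hm⟩ := Complex.exp_eq_exp_iff_exists_int.1 (add_right_cancel hz)
  obtain ⟨⟨s', t'⟩, hx', he, hs'⟩ := exists_modelMap_eq (modelMap_mem_X hx) m
  have h1 : shift s = shift s' := (congr_arg Prod.fst he).symm
  have ht : t = t' := by
    rw [modelMap_congr h1] at he
    simpa [modelMap] using (congr_arg Prod.snd he).symm
  subst ht
  refine ⟨_, hx', he, ?_⟩
  simp only at hs hs'
  rw [hG.apply_congr h1 hx, hm, hs, hs']
  push_cast
  ring

/-- The image of a correspondence is backward invariant. -/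
theorem exists_iterate_apply_eq (hG : IsCorrespondence κ G) (n : ℕ) {y : Address × ℝ}
    (hy : y ∈ X) {z : ℂ} (hz : (E κ)^[n] z = G y) :
    ∃ x ∈ X, modelMap^[n] x = y ∧ G x = z := by
  induction n generalizing y with
  | zero => exact ⟨y, hy, rfl, hz.symm⟩
  | succ n ih =>
    rw [Function.iterate_succ_apply'] at hz
    obtain ⟨x, hx, rfl, hx'⟩ := hG.exists_apply_eq hy hz
    obtain ⟨w, hw, rfl, hw'⟩ := ih hx hx'.symm
    exact ⟨w, hw, Function.iterate_succ_apply' .., hw'⟩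

end IsCorrespondence

/-! ### Expansion at escaping points -/

theorem isOpenMap_E (κ : ℂ) : IsOpenMap (E κ) :=
  (Homeomorph.addRight κ).isOpenMap.comp Complex.isOpenMap_exp

theorem isOpenMap_iterate_E (κ : ℂ) (n : ℕ) : IsOpenMap (E κ)^[n] := by
  induction n with
  | zero => exact IsOpenMap.id
  | succ n ih => rw [Function.iterate_succ']; exact (isOpenMap_E κ).comp ih

/-- Far from the singular value, a branch of the inverse of `E κ` contracts discs of radius at
most `4` by the factor `2`. -/
theorem ball_subset_image_E {κ z : ℂ} (hz : 16 ≤ ‖E κ z - κ‖) {r : ℝ} (hr : r ≤ 4) :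
    Metric.ball (E κ z) r ⊆ E κ '' Metric.ball z (r / 2) := by
  intro w hw
  rw [mem_ball_iff_norm] at hw
  set v := (w - E κ z) / (E κ z - κ) with hv
  have hpos : 0 < ‖E κ z - κ‖ := by linarith
  have hv1 : ‖v‖ ≤ ‖w - E κ z‖ / 16 := by
    rw [hv, norm_div]
    gcongr
  have hv2 : ‖v‖ ≤ 1 / 2 := by linarith
  have hv0 : 1 + v ≠ 0 := by
    intro h
    rw [← neg_eq_of_add_eq_zero_right h, norm_neg, norm_one] at hv2
    norm_num at hv2
  have hne : E κ z - κ ≠ 0 := norm_pos_iff.1 hpos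
  refine ⟨z + Complex.log (1 + v), ?_, ?_⟩
  · rw [mem_ball_iff_norm, add_sub_cancel_left]
    have := Complex.norm_log_one_add_half_le_self hv2
    have := norm_nonneg (w - E κ z)
    linarith
  · have h1 : Complex.exp z = E κ z - κ := by rw [E, add_sub_cancel_right]
    rw [E, Complex.exp_add, Complex.exp_log hv0, h1, hv]
    field_simp
    ring

/-- Neighbourhoods of an escaping point are blown up to discs of radius `4`. -/
theorem exists_ball_subset_iterate_image {κ p : ℂ} (hp : p ∈ escapingSet κ) {U : Set ℂ}
    (hU : U ∈ 𝓝 p) : ∀ᶠ n in atTop, Metric.ball ((E κ)^[n] p) 4 ⊆ (E κ)^[n] '' U := by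
  have hlarge : ∀ᶠ n in atTop, 16 ≤ ‖(E κ)^[n + 1] p - κ‖ := by
    rw [mem_escapingSet_iff] at hp
    filter_upwards [(tendsto_add_atTop_iff_nat 1).2 hp |>.eventually_ge_atTop (16 + ‖κ‖)] with n hn
    have := norm_sub_norm_le ((E κ)^[n + 1] p) κ
    linarith
  obtain ⟨m, hm⟩ := eventually_atTop.1 hlarge
  have hopen : IsOpenMap (E κ)^[m] := isOpenMap_iterate_E κ m
  obtain ⟨ε, hε, hball⟩ := Metric.mem_nhds_iff.1 (hopen.image_mem_nhds hU)
  have hstep : ∀ j, Metric.ball ((E κ)^[m + j] p) (min 4 (ε * 2 ^ j)) ⊆ (E κ)^[m + j] '' U := by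
    intro j
    induction j with
    | zero =>
      refine (Metric.ball_subset_ball ?_).trans hball
      simp
    | succ j ih =>
      have h1 := ball_subset_image_E (κ := κ) (z := (E κ)^[m + j] p)
        (r := min 4 (ε * 2 ^ (j + 1)))
        (by rw [← Function.iterate_succ_apply' (E κ)]; exact hm (m + j) (Nat.le_add_right m j))
        (min_le_left _ _)
      rw [← Function.iterate_succ_apply' (E κ)] at h1
      refine h1.trans ?_
      rw [← Nat.add_assoc, Function.iterate_succ', image_comp]
      refine image_mono ((Metric.ball_subset_ball ?_).trans ih)
      rw [le_min_iff]
      constructor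
      · linarith [min_le_left 4 (ε * 2 ^ (j + 1))]
      · have := min_le_right 4 (ε * 2 ^ (j + 1))
        rw [pow_succ] at this
        rw [pow_succ]
        linarith
  have hgrow : ∀ᶠ j : ℕ in atTop, 4 ≤ ε * 2 ^ j :=
    ((tendsto_pow_atTop_atTop_of_one_lt (one_lt_two (α := ℝ))).const_mul_atTop
      hε).eventually_ge_atTop 4
  obtain ⟨j₀, hj₀⟩ := eventually_atTop.1 hgrow
  refine eventually_atTop.2 ⟨m + j₀, fun n hn => ?_⟩
  obtain ⟨j, rfl⟩ := Nat.exists_eq_add_of_le (show m ≤ n by omega)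
  have := hstep j
  rwa [min_eq_left (hj₀ j (by omega))] at this

theorem tendsto_re_iterate {κ p : ℂ} (hp : p ∈ escapingSet κ) :
    Tendsto (fun n : ℕ => ((E κ)^[n] p).re) atTop atTop := by
  rw [mem_escapingSet_iff] at hp
  have h1 : Tendsto (fun n : ℕ => Real.log (‖(E κ)^[n + 1] p‖ - ‖κ‖)) atTop atTop :=
    Real.tendsto_log_atTop.comp
      (tendsto_atTop_add_const_right _ _ ((tendsto_add_atTop_iff_nat 1).2 hp))
  refine tendsto_atTop_mono' _ ?_ h1
  filter_upwards [(tendsto_add_atTop_iff_nat 1).2 hp |>.eventually_gt_atTop ‖κ‖] with n hn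
  rw [Real.log_le_iff_le_exp (sub_pos.2 hn), Function.iterate_succ_apply']
  have h2 := norm_add_le (Complex.exp ((E κ)^[n] p)) κ
  rw [Complex.norm_exp] at h2
  change ‖Complex.exp ((E κ)^[n] p) + κ‖ - ‖κ‖ ≤ _
  linarith

/-- A nonzero number has a logarithm with imaginary part within `π` of a given number. -/
theorem exists_log_near {v : ℂ} (hv : v ≠ 0) (b : ℝ) :
    ∃ u : ℂ, Complex.exp u = v ∧ u.re = Real.log ‖v‖ ∧ |u.im - b| ≤ Real.pi := by
  have hπ := Real.pi_pos
  set k : ℤ := round ((b - v.arg) / (2 * Real.pi)) with hk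
  refine ⟨Complex.log v + 2 * Real.pi * Complex.I * k, ?_, ?_, ?_⟩
  · rw [Complex.exp_add, Complex.exp_log hv, exp_two_pi_int, mul_one]
  · simp [Complex.log_re]
  · have h1 := abs_sub_round ((b - v.arg) / (2 * Real.pi))
    have h2 : (Complex.log v + 2 * Real.pi * Complex.I * k).im - b
        = -((b - v.arg) / (2 * Real.pi) - k) * (2 * Real.pi) := by
      simp [Complex.log_im]
      field_simp
      ring
    rw [h2, abs_mul, abs_neg, abs_of_pos (show 0 < 2 * Real.pi by positivity)]
    nlinarith

/-- Neighbourhoods of an escaping point are blown up to annuli about the singular value. A disc of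
radius `4` far to the right covers the annulus `e^{a-1} ≤ |w - κ| ≤ e^{a+1}`; this contains
a segment of a vertical strip of any given width and of height `2π`, whose image is a given round
annulus. -/
theorem exists_annulus_subset_iterate_image {κ p : ℂ} (hp : p ∈ escapingSet κ) {U : Set ℂ}
    (hU : U ∈ 𝓝 p) {r R : ℝ} (hr : 0 < r) :
    ∃ n, {z : ℂ | r ≤ ‖z - κ‖ ∧ ‖z - κ‖ ≤ R} ⊆ (E κ)^[n + 1] '' U := by
  set C := max |Real.log r| |Real.log R| with hC
  have hlim : Tendsto (fun n : ℕ => Real.exp ((E κ)^[n] p).re) atTop atTop :=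
    Real.tendsto_exp_atTop.comp (tendsto_re_iterate hp)
  obtain ⟨n, hball, hbig⟩ := ((exists_ball_subset_iterate_image hp hU).and
    (hlim.eventually_ge_atTop (2 * (Real.pi + C + ‖κ‖) + 1))).exists
  refine ⟨n + 1, fun z hz => ?_⟩
  set a := ((E κ)^[n] p).re with ha
  set A := Real.exp a with hA
  have hπ := Real.pi_pos
  have hz0 : 0 < ‖z - κ‖ := hr.trans_le hz.1
  obtain ⟨w, hw, hwre, hwim⟩ := exists_log_near (norm_pos_iff.1 hz0) A
  have hwC : |w.re| ≤ C := by
    rw [hwre]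
    exact abs_le_max_abs_abs (Real.log_le_log hr hz.1) (Real.log_le_log hz0 hz.2)
  have hwA : ‖w - κ - A * Complex.I‖ ≤ Real.pi + C + ‖κ‖ := by
    have h1 : ‖w - A * Complex.I‖ ≤ C + Real.pi := by
      refine (Complex.norm_le_abs_re_add_abs_im _).trans ?_
      simpa using add_le_add hwC hwim
    calc ‖w - κ - A * Complex.I‖ = ‖(w - A * Complex.I) - κ‖ := by ring_nf
      _ ≤ ‖w - A * Complex.I‖ + ‖κ‖ := norm_sub_le _ _
      _ ≤ _ := by linarith
  have hAn : ‖(A : ℂ) * Complex.I‖ = A := by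
    rw [norm_mul, Complex.norm_I, mul_one, Complex.norm_real, Real.norm_eq_abs,
      abs_of_pos (Real.exp_pos a)]
  have hup : ‖w - κ‖ ≤ A + (Real.pi + C + ‖κ‖) := by
    have := norm_le_norm_add_norm_sub' (w - κ) (A * Complex.I)
    linarith
  have hlow : A ≤ ‖w - κ‖ + (Real.pi + C + ‖κ‖) := by
    have := norm_le_norm_add_norm_sub (w - κ) (A * Complex.I)
    linarith
  have hwpos : 0 < ‖w - κ‖ := by linarith [norm_nonneg κ, (abs_nonneg w.re).trans hwC]
  obtain ⟨u, hu, hure, huim⟩ := exists_log_near (norm_pos_iff.1 hwpos) ((E κ)^[n] p).im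
  have hure' : |u.re - a| ≤ 1 := by
    have h1 := Real.exp_one_gt_d9
    have h2 : Real.log ‖w - κ‖ ≤ a + 1 := by
      rw [Real.log_le_iff_le_exp hwpos, Real.exp_add]
      nlinarith [Real.exp_pos a]
    have h3 : a - 1 ≤ Real.log ‖w - κ‖ := by
      rw [Real.le_log_iff_exp_le hwpos, Real.exp_sub, div_le_iff₀ (Real.exp_pos 1)]
      nlinarith [Real.exp_pos a]
    rw [hure, abs_le]
    constructor <;> linarith
  have hmem : u ∈ Metric.ball ((E κ)^[n] p) 4 := by
    rw [mem_ball_iff_norm]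
    refine lt_of_pow_lt_pow_left₀ 2 (by norm_num) ?_
    rw [Complex.sq_norm, Complex.normSq_apply, Complex.sub_re, Complex.sub_im, ← ha]
    have h1 := Real.pi_lt_d2
    have h2 := sq_le_sq' (abs_le.1 hure').1 (abs_le.1 hure').2
    have h3 := sq_le_sq' (abs_le.1 huim).1 (abs_le.1 huim).2
    nlinarith
  obtain ⟨y, hy, hyu⟩ := hball hmem
  refine ⟨y, hy, ?_⟩
  rw [Function.iterate_succ_apply', Function.iterate_succ_apply', hyu]
  simp only [E]
  rw [hu, sub_add_cancel, hw, sub_add_cancel]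

/-! ### Limit sets of rays -/

theorem mem_limitSet_iff {g : ℝ → ℂ} {z : ℂ} :
    z ∈ limitSet g ↔ ∀ t > 0, ∀ ε > 0, ∃ u ∈ Ioo 0 t, dist z (g u) < ε := by
  simp [limitSet, Metric.mem_closure_iff]

/-- If the limit set of a curve is nonempty and bounded, then the curve is bounded near its
starting point: otherwise it would cross some fixed circle arbitrarily close to its starting point,
and would accumulate on this circle. -/
theorem exists_norm_le_of_limitSet_bounded {g : ℝ → ℂ} (hg : ContinuousOn g (Ioi 0))
    (hb : Bornology.IsBounded (limitSet g)) (hne : (limitSet g).Nonempty) :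
    ∃ R, ∃ t > 0, ∀ u ∈ Ioo 0 t, ‖g u‖ ≤ R := by
  obtain ⟨R, hR⟩ := hb.exists_norm_le
  obtain ⟨q, hq⟩ := hne
  by_contra! hcon
  have hcross : ∀ t > 0, ∃ u ∈ Ioo 0 t, ‖g u‖ = R + 1 := by
    intro t ht
    obtain ⟨a, ha, hqa⟩ := mem_limitSet_iff.1 hq t ht 1 one_pos
    obtain ⟨b, hb, hlt⟩ := hcon (R + 1) t ht
    have h1 : ‖g a‖ ≤ R + 1 := by
      have h2 := hR q hq
      rw [dist_comm, dist_eq_norm] at hqa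
      have h3 := norm_le_norm_add_norm_sub' (g a) q
      linarith
    exact isPreconnected_Ioo.intermediate_value ha hb
      (hg.mono fun u hu => hu.1).norm ⟨h1, hlt.le⟩
  choose u hu hnorm using fun n : ℕ => hcross (1 / ((n : ℝ) + 1)) Nat.one_div_pos_of_nat
  obtain ⟨z, hz, φ, hφ, hlim⟩ := (isCompact_sphere (0 : ℂ) (R + 1)).tendsto_subseq
    (x := fun n => g (u n)) fun n => by rw [mem_sphere_zero_iff_norm, hnorm]
  have hzΛ : z ∈ limitSet g := by
    rw [limitSet, mem_iInter₂]
    intro t ht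
    refine mem_closure_of_tendsto hlim ?_
    filter_upwards [(tendsto_one_div_add_atTop_nhds_zero_nat.comp
      hφ.tendsto_atTop).eventually_lt_const (mem_Ioi.1 ht)] with n hn
    exact ⟨_, ⟨(hu _).1, (hu _).2.trans hn⟩, rfl⟩
  have := hR z hzΛ
  rw [mem_sphere_zero_iff_norm.1 hz] at this
  linarith

theorem exists_annulus_of_limitSet {g : ℝ → ℂ} (hg : ContinuousOn g (Ioi 0))
    (hb : Bornology.IsBounded (limitSet g)) (hne : (limitSet g).Nonempty) {c : ℂ}
    (hc : c ∉ limitSet g) :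
    ∃ r > 0, ∃ R, ∃ t > 0, ∀ u ∈ Ioo 0 t, r ≤ ‖g u - c‖ ∧ ‖g u - c‖ ≤ R := by
  obtain ⟨R, t₁, ht₁, hR⟩ := exists_norm_le_of_limitSet_bounded hg hb hne
  rw [mem_limitSet_iff] at hc
  push Not at hc
  obtain ⟨t₂, ht₂, r, hr, hdist⟩ := hc
  refine ⟨r, hr, R + ‖c‖, min t₁ t₂, lt_min ht₁ ht₂, fun u hu => ⟨?_, ?_⟩⟩
  · rw [← dist_eq_norm, dist_comm]
    exact hdist u ⟨hu.1, hu.2.trans_le (min_le_right _ _)⟩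
  · have h1 := norm_sub_le (g u) c
    have h2 := hR u ⟨hu.1, hu.2.trans_le (min_le_left _ _)⟩
    linarith

theorem continuousOn_ray {κ : ℂ} (hκ : κ ∉ escapingSet κ) {s : Address} (hs : ExpBounded s) :
    ContinuousOn (ray κ s) (Ioi 0) :=
  ((isCorrespondence_corr hκ).continuous_along_rays s).comp
    (f := fun t => t + minPotential s) (by fun_prop) fun _ ht => add_minPotential_mem_X hs ht

/-- The singular value is omitted by `E κ`, so it has positive distance from the image of a disc
under an iterate. -/
theorem exists_le_dist_iterate (κ : ℂ) (R : ℝ) (n : ℕ) :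
    ∃ ε > 0, ∀ z : ℂ, ‖z‖ ≤ R → ε ≤ dist κ ((E κ)^[n + 1] z) := by
  have hc : Continuous (E κ) := by unfold E; fun_prop
  have hclosed := ((isCompact_closedBall (0 : ℂ) R).image (hc.iterate (n + 1))).isClosed
  have hmem : κ ∈ ((E κ)^[n + 1] '' Metric.closedBall 0 R)ᶜ := by
    rintro ⟨z, -, hz⟩
    rw [Function.iterate_succ_apply', E, add_eq_right] at hz
    exact Complex.exp_ne_zero _ hz
  obtain ⟨ε, hε, hball⟩ := Metric.mem_nhds_iff.1 (hclosed.isOpen_compl.mem_nhds hmem)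
  refine ⟨ε, hε, fun z hz => ?_⟩
  by_contra! hlt
  rw [dist_comm] at hlt
  exact hball hlt ⟨z, by simpa using hz, rfl⟩

/-- Conjugating by the model: an iterated preimage of a point of a ray is mapped to an iterated
preimage of the point of the corresponding ray at the same potential. -/
theorem iterate_corr_corrInv {κ κ' : ℂ} (hκ : κ ∉ escapingSet κ) (hκ' : κ' ∉ escapingSet κ')
    {s : Address} (hs : ExpBounded s) {t : ℝ} (ht : 0 < t) {n : ℕ} {z : ℂ}
    (hz : (E κ)^[n] z = ray κ s t) :
    (E κ')^[n] (corr κ' (corrInv κ z)) = ray κ' s t := by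
  have hG := isCorrespondence_corr hκ
  have hG' := isCorrespondence_corr hκ'
  obtain ⟨x, hx, hxn, rfl⟩ := hG.exists_iterate_apply_eq n (add_minPotential_mem_X hs ht) hz
  rw [corrInv, hG.injOn.leftInvOn_invFunOn hx, hG'.iterate_apply hx, hxn, ray]

end ExpDynamics

open ExpDynamics in
theorem mainTheorem11 (s : ExpDynamics.Address) (hs : ExpDynamics.ExpBounded s)
    (κ' κ : ℂ)
    (hκ' : κ' ∉ ExpDynamics.escapingSet κ')
    (hκ : κ ∉ ExpDynamics.escapingSet κ)
    (hlim' : κ' ∈ ExpDynamics.limitSet (ExpDynamics.ray κ' s))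
    (hlim : κ ∉ ExpDynamics.limitSet (ExpDynamics.ray κ s))
    (hbdd : Bornology.IsBounded (ExpDynamics.limitSet (ExpDynamics.ray κ s)))
    (hne : (ExpDynamics.limitSet (ExpDynamics.ray κ s)).Nonempty) :
    ¬ ContinuousOn (fun z : ℂ => ExpDynamics.corr κ' (ExpDynamics.corrInv κ z))
        (ExpDynamics.escapingSet κ) := by
  intro hcont
  have hray : ∀ t > 0, ray κ s t ∈ escapingSet κ := fun t ht =>
    (isCorrespondence_corr hκ).mem_escapingSet (add_minPotential_mem_X hs ht)
  have hp := hray 1 one_pos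
  set p := ray κ s 1
  set f := fun z : ℂ => corr κ' (corrInv κ z)
  -- By continuity at the escaping point `p`, the map `f` is bounded near `p`.
  have hnear : ∀ᶠ z in 𝓝 p, z ∈ escapingSet κ → ‖f z‖ ≤ ‖f p‖ + 1 :=
    eventually_nhdsWithin_iff.1
      ((hcont p hp).norm.eventually_le_const (show ‖f p‖ < ‖f p‖ + 1 by linarith))
  obtain ⟨r, hr, R, t₀, ht₀, hann⟩ :=
    exists_annulus_of_limitSet (continuousOn_ray hκ hs) hbdd hne hlim
  obtain ⟨n, hn⟩ := exists_annulus_subset_iterate_image hp hnear hr (R := R)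
  -- The number `n` is chosen before the potential `t`, which may therefore depend on `n`.
  obtain ⟨ε, hε, hfar⟩ := exists_le_dist_iterate κ' (‖f p‖ + 1) n
  obtain ⟨t, ht, hclose⟩ := mem_limitSet_iff.1 hlim' t₀ ht₀ ε hε
  obtain ⟨z, hz, hzt⟩ := hn (hann t ht)
  have hzI : z ∈ escapingSet κ := by
    rw [← iterate_E_mem_escapingSet (n := n + 1), hzt]
    exact hray t ht.1
  have h := hfar (f z) (hz hzI)
  rw [iterate_corr_corrInv hκ hκ' hs ht.1 hzt] at h
  exact absurd hclose (not_lt.2 h)
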